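/- **Theorem (Global Convergence).** Finitely many robots move on the real line in synchronous rounds $t=0,1,2,\dots$, with visibility radius $V>0$; robots $i,j$ see each other at time $t$ iff $|x_i(t)-x_j(t)|\le V$ (so each robot sees itself). Exactly two robots $a,b$ are crashed: they never move, and $x_a<x_b$. Every other robot runs Convergence1D: $x_i(t+1)=\tfrac12\bigl(l_i(t)+r_i(t)\bigr)$, where $l_i(t)$ and $r_i(t)$ are the positions of the leftmost and of the rightmost robot that $i$ sees at time $t$. Then, from every initial configuration: 1. $|x_i(t+1)-x_i(t)|\to 0$ as $t\to\infty$, for every robot $i$. 2. There is a fixed configuration $P=(P_i)_i$ with $x_i(t)\to P_i$ as $t\to\infty$, for every robot $i$. Suppose moreover that the visibility graph (robots adjacent iff they see each other) is connected at time $0$. We use the following notions. * Robots at the same position are identified in the notions below (non-faulty ones behave as a single robot from then on). * A time $T$ is *size-stable* if, from $T$ on, no robot comes into sight of another; the relative order of any two robots (left of, equal to, right of) does not change; at most one position to the left of $x_a$ and at most one position to the right of $x_b$ is occupied; and a robot that is to the left of $x_a$ (to the right of $x_b$) at time $T$ converges to $x_a$ (to $x_b$). * A *mutual chain* is a nonempty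 sequence of robots $y_1,\dots,y_k$ at increasing positions such that $y_{i+1}$ is the rightmost robot visible from $y_i$ and $y_i$ is the leftmost robot visible from $y_{i+1}$, for $1\le i<k$. It is *anchored* at $u$ and $v$ if $u$ is the leftmost robot visible from $y_1$, $v$ is the rightmost robot visible from $y_k$, and $u<y_1$, $y_k<v$. * A *primary chain* (*level-$1$ chain*) is a mutual chain whose first robot is $a$ and whose last robot is $b$. For $j\ge 2$, a *level-$j$ chain* is a mutual chain anchored at two robots, one of which belongs to a level-$(j-1)$ chain and the other to a level-$j'$ chain for some $j'<j$. Then: 3. A size-stable time exists. 4. For every size-stable time $T$: * There is a primary chain that is the same at all times $t\ge T$, and at each such time it is the unique one. If $y_0=a,y_1,\dots,y_k=b$ is the primary chain, then $P_{y_i}=x_a+\frac{i}{k}(x_b-x_a)$ for $0\le i\le k$. * Every level-$j$ chain at time $T$ is a level-$j$ chain at all times $t\ge T$. If $y_1,\dots,y_k$ is a level-$j$ chain at time $T$ with $j\ge2$, anchored at $u$ and $v$, then its limit positions are equidistant between those of its anchors: $P_{y_i}=P_u+\frac{i}{k+1}(P_v-P_u)$ for $1\le i\le k$. * Every robot $i$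 belongs to a level-$j$ chain for some $j\ge1$, unless it stays to the left of $x_a$ at all times $t\ge T$ and $P_i=x_a$, or it stays to the right of $x_b$ at all times $t\ge T$ and $P_i=x_b$. -/

import Mathlib

open Filter Topology

noncomputable section

namespace Robots

variable {ι : Type*}

/-- With visibility radius `V`, robot `j` is visible from robot `i` in the configuration `p`. -/
def Visible (V : ℝ) (p : ι → ℝ) (i j : ι) : Prop :=
  |p i - p j| ≤ V

/-- The visibility graph of the configuration `p`: distinct robots at distance at most `V` are
adjacent. -/
def visibilityGraph (V : ℝ) (p : ι → ℝ) : SimpleGraph ι where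
  Adj i j := i ≠ j ∧ |p i - p j| ≤ V
  symm := ⟨fun i j h => ⟨h.1.symm, by rw [abs_sub_comm]; exact h.2⟩⟩
  loopless := ⟨fun _ h => h.1 rfl⟩

/-- The position `l(i)` of the leftmost robot visible from `i`. There are finitely many robots and
`i` sees itself (`V > 0`), so the infimum is a minimum. -/
def leftmost (V : ℝ) (p : ι → ℝ) (i : ι) : ℝ :=
  sInf (p '' {j | Visible V p i j})

/-- The position `r(i)` of the rightmost robot visible from `i`. -/
def rightmost (V : ℝ) (p : ι → ℝ) (i : ι) : ℝ :=
  sSup (p '' {j | Visible V p i j})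

open Classical in
/-- One synchronous round of Convergence1D. The crashed robots `a` and `b` stay where they are; every
other robot moves to the midpoint between the farthest robots that it sees. -/
def step (V : ℝ) (a b : ι) (p : ι → ℝ) : ι → ℝ := fun i =>
  if i = a ∨ i = b then p i else (leftmost V p i + rightmost V p i) / 2

/-- The configuration at time `t` of the execution that starts from `p`. -/
def config (V : ℝ) (a b : ι) (p : ι → ℝ) (t : ℕ) : ι → ℝ :=
  (step V a b)^[t] p

/-- `T` is a size-stable time of the trajectory `X`: from `T` on,
* no robot comes into sight of another one (no inclusion);
* two robots never change their relative order, they neither cross, nor merge, nor separate;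
* at most one position to the left of `[a, b]` and at most one to its right is occupied (robots
  that have merged count as one), and these outsiders converge to `a` and to `b`, respectively. -/
structure IsSizeStable (V : ℝ) (a b : ι) (X : ℕ → ι → ℝ) (T : ℕ) : Prop where
  no_inclusion : ∀ t ≥ T, ∀ i j, Visible V (X (t + 1)) i j → Visible V (X t) i j
  same_order : ∀ t ≥ T, ∀ i j, X (t + 1) i < X (t + 1) j ↔ X t i < X t j
  left_unique : ∀ t ≥ T, ∀ i j, X t i < X t a → X t j < X t a → X t i = X t j
  right_unique : ∀ t ≥ T, ∀ i j, X t b < X t i → X t b < X t j → X t i = X t j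
  left_tendsto : ∀ i, X T i < X T a → Tendsto (fun t => X t i) atTop (𝓝 (X T a))
  right_tendsto : ∀ i, X T b < X T i → Tendsto (fun t => X t i) atTop (𝓝 (X T b))

/-- A mutual chain: a nonempty list of robots, from left to right, such that of any two consecutive
ones the right one is the rightmost robot visible from the left one, and the left one is the leftmost
robot visible from the right one. Robots are compared through their positions because robots that
have merged count as one. -/
def IsMutualChain (V : ℝ) (p : ι → ℝ) (L : List ι) : Prop :=
  L ≠ [] ∧ L.IsChain fun u v => p u < p v ∧ rightmost V p u = p v ∧ leftmost V p v = p u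

/-- The list of robots `L` is anchored at `u` and `v`: the leftmost robot visible from its first
robot is `u`, the rightmost robot visible from its last robot is `v`, and these anchors lie outside
the list. -/
def IsAnchoredAt (V : ℝ) (p : ι → ℝ) (L : List ι) (u v : ι) : Prop :=
  ∃ h : L ≠ [],
    (leftmost V p (L.head h) = p u ∧ p u < p (L.head h)) ∧
    (rightmost V p (L.getLast h) = p v ∧ p (L.getLast h) < p v)

/-- A primary chain: a mutual chain that starts at the left crashed robot `a` and ends at the right
crashed robot `b`. -/
def IsPrimaryChain (V : ℝ) (a b : ι) (p : ι → ℝ) (L : List ι) : Prop :=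
  IsMutualChain V p L ∧ L.head? = some a ∧ L.getLast? = some b

/-- `IsLevelChain V a b p j L`: in the configuration `p` the list `L` is a level-`j` chain. Level 1
is the primary chain. A chain of level `j + 1` is a mutual chain with one anchor in a chain of
level `j` and the other anchor in a chain of some level `j' < j + 1`. -/
inductive IsLevelChain (V : ℝ) (a b : ι) (p : ι → ℝ) : ℕ → List ι → Prop
  | primary {L : List ι} : IsPrimaryChain V a b p L → IsLevelChain V a b p 1 L
  | left {j j' : ℕ} {L L₁ L₂ : List ι} {u v : ι} :
      IsMutualChain V p L → IsAnchoredAt V p L u v →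
      IsLevelChain V a b p j L₁ → u ∈ L₁ →
      IsLevelChain V a b p j' L₂ → v ∈ L₂ → j' < j + 1 →
      IsLevelChain V a b p (j + 1) L
  | right {j j' : ℕ} {L L₁ L₂ : List ι} {u v : ι} :
      IsMutualChain V p L → IsAnchoredAt V p L u v →
      IsLevelChain V a b p j' L₁ → u ∈ L₁ →
      IsLevelChain V a b p j L₂ → v ∈ L₂ → j' < j + 1 →
      IsLevelChain V a b p (j + 1) L

/-- From time `T` on, the robots of the trajectory `X` with limit configuration `P` are organized in
hierarchical chains whose limits are equidistant. -/
structure IsHierarchical (V : ℝ) (a b : ι) (X : ℕ → ι → ℝ) (P : ι → ℝ) (T : ℕ) : Prop where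
  /-- There is a primary chain, the same at all times `t ≥ T`. -/
  exists_primary : ∃ L, ∀ t ≥ T, IsPrimaryChain V a b (X t) L
  /-- The primary chain is unique (up to a choice between robots that have merged). -/
  primary_unique : ∀ t ≥ T, ∀ L L', IsPrimaryChain V a b (X t) L → IsPrimaryChain V a b (X t) L' →
    L.map (X t) = L'.map (X t)
  /-- The limit positions of a primary chain `y₀, …, yₖ` divide the segment between the crashed
  robots into `k` equal parts. -/
  primary_equidistant : ∀ L, IsPrimaryChain V a b (X T) L → ∀ (i : ℕ) (hi : i < L.length),
    P L[i] = P a + i * ((P b - P a) / ((L.length : ℝ) - 1))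
  /-- Level chains persist. -/
  level_persists : ∀ j L, IsLevelChain V a b (X T) j L → ∀ t ≥ T, IsLevelChain V a b (X t) j L
  /-- The limit positions of a chain `y₁, …, yₖ` of level at least 2 divide the segment between the
  limits of its anchors into `k + 1` equal parts. -/
  level_equidistant : ∀ j L u v, 2 ≤ j → IsLevelChain V a b (X T) j L →
    IsAnchoredAt V (X T) L u v → ∀ (i : ℕ) (hi : i < L.length),
    P L[i] = P u + ((i : ℝ) + 1) * ((P v - P u) / ((L.length : ℝ) + 1))
  /-- Every robot belongs to a level chain, except for the outsiders, which stay outside the segment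
  between the crashed robots forever and converge to its end points. -/
  covers : ∀ i,
    (∃ j L, IsLevelChain V a b (X T) j L ∧ i ∈ L) ∨
    ((∀ t ≥ T, X t i < X t a) ∧ P i = P a) ∨
    ((∀ t ≥ T, X t b < X t i) ∧ P i = P b)

end Robots

end

/-! ### Visibility, extreme visible robots and reflection. -/

namespace Robots

variable {ι : Type*} {V : ℝ} {a b : ι}

/-! Visibility is never lost (`visible_succ`), so it is eventually constant. From then on the upper
and the lower limits of the positions satisfy one-sided midpoint inequalities, and a maximum
principle for the oscillation, limsup minus liminf, forces every robot to converge
(`exists_tendsto_of_visible_iff`). Connectivity plays no role here.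

The limit `P` of a non-faulty robot is the midpoint of the extreme limits that it sees
(`exists_harmonic`). If the graph is connected, all limits lie between those of `a` and `b`, and
robots converging to a crashed robot are outsiders that merge. Once the order is constant, any two
non-faulty robots with the same limit have merged (`eq_of_limit_eq`), so equalities between limits
become equalities between positions.

Let `rho i` and `lam i` be the extreme robots seen by `i`, and call `P (rho i) - P i` the right gap
of `i`. For `i` in the segment with `i` and `rho i` different from `b`, the midpoint property at
`rho i` shows that the gap does not decrease from `i` to `rho i`; if it stays the same, `lam (rho
i)` has merged with `i`, and the link is mutual. On the path from `a` to `b` the gaps are squeezed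
between equal values, which gives the primary chain (`exists_primary`). Among robots in no level
chain, those of largest gap form, by the same argument, a mutual chain anchored at robots in level
chains (`exists_isLevelChain`). Along any chain the midpoint property makes `P` affine in the index
(`eq_add_mul_of_midpoint`). -/

theorem Visible.symm {p : ι → ℝ} {i j : ι} (h : Visible V p i j) : Visible V p j i := by
  unfold Visible at *; rwa [abs_sub_comm]

theorem visible_self (hV : 0 ≤ V) (p : ι → ℝ) (i : ι) : Visible V p i i := by
  simpa [Visible] using hV

theorem visible_neg {p : ι → ℝ} {i j : ι} : Visible V (-p) i j ↔ Visible V p i j := by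
  simp only [Visible, Pi.neg_apply]
  rw [← abs_neg]
  ring_nf

theorem leftmost_neg (p : ι → ℝ) (i : ι) : leftmost V (-p) i = -rightmost V p i := by
  have h : (-p) '' {j | Visible V (-p) i j} = -(p '' {j | Visible V p i j}) := by
    ext x
    simp only [visible_neg, Set.mem_image, Set.mem_ofPred_eq, Pi.neg_apply, Set.mem_neg]
    exact exists_congr fun j => and_congr_right fun _ => neg_eq_iff_eq_neg
  rw [leftmost, h, Real.sInf_def, neg_neg, rightmost]

theorem rightmost_neg (p : ι → ℝ) (i : ι) : rightmost V (-p) i = -leftmost V p i := by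
  rw [← neg_neg p, leftmost_neg, neg_neg, neg_neg]

section Finite

variable [Finite ι]

theorem exists_leftmost (hV : 0 ≤ V) (p : ι → ℝ) (i : ι) :
    ∃ l, Visible V p i l ∧ leftmost V p i = p l := by
  have hne : (p '' {j | Visible V p i j}).Nonempty := ⟨p i, i, visible_self hV p i, rfl⟩
  obtain ⟨l, hl, h⟩ := hne.csInf_mem (Set.toFinite _)
  exact ⟨l, hl, h.symm⟩

theorem leftmost_le {p : ι → ℝ} {i j : ι} (h : Visible V p i j) : leftmost V p i ≤ p j :=
  csInf_le (Set.toFinite _).bddBelow ⟨j, h, rfl⟩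

theorem exists_rightmost (hV : 0 ≤ V) (p : ι → ℝ) (i : ι) :
    ∃ r, Visible V p i r ∧ rightmost V p i = p r := by
  obtain ⟨r, hr, h⟩ := exists_leftmost hV (-p) i
  rw [leftmost_neg] at h
  exact ⟨r, visible_neg.1 hr, by simpa using h⟩

theorem le_rightmost {p : ι → ℝ} {i j : ι} (h : Visible V p i j) : p j ≤ rightmost V p i :=
  le_csSup (Set.toFinite _).bddAbove ⟨j, h, rfl⟩

theorem sub_le_leftmost (hV : 0 ≤ V) (p : ι → ℝ) (i : ι) : p i - V ≤ leftmost V p i := by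
  obtain ⟨l, hl, h⟩ := exists_leftmost hV p i
  rw [h]
  linarith [(abs_le.1 hl).2]

theorem rightmost_le_add (hV : 0 ≤ V) (p : ι → ℝ) (i : ι) : rightmost V p i ≤ p i + V := by
  obtain ⟨l, hl, h⟩ := exists_rightmost hV p i
  rw [h]
  linarith [(abs_le.1 hl).1]

theorem leftmost_mono (hV : 0 ≤ V) {p : ι → ℝ} {i j : ι} (h : p i ≤ p j) :
    leftmost V p i ≤ leftmost V p j := by
  obtain ⟨l, hl, hl'⟩ := exists_leftmost hV p j
  rw [hl']
  by_contra! hc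
  have hi := leftmost_le (visible_self hV p i)
  refine (leftmost_le (V := V) (p := p) (i := i) (j := l) ?_).not_gt hc
  exact abs_le.2 ⟨by linarith, by linarith [(abs_le.1 hl).2]⟩

theorem rightmost_mono (hV : 0 ≤ V) {p : ι → ℝ} {i j : ι} (h : p i ≤ p j) :
    rightmost V p i ≤ rightmost V p j := by
  have := leftmost_mono hV (p := -p) (i := j) (j := i) (by simpa using h)
  simpa [leftmost_neg] using this

end Finite

/-- `X` is an execution of Convergence1D in which the robots `a` and `b` are crashed. -/
structure IsTrajectory (V : ℝ) (a b : ι) (X : ℕ → ι → ℝ) : Prop where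
  pos : 0 < V
  left_fixed : ∀ t, X t a = X 0 a
  right_fixed : ∀ t, X t b = X 0 b
  move : ∀ t i, i ≠ a → i ≠ b →
    X (t + 1) i = (leftmost V (X t) i + rightmost V (X t) i) / 2

theorem isTrajectory_config (hV : 0 < V) (p : ι → ℝ) : IsTrajectory V a b (config V a b p) where
  pos := hV
  left_fixed t := by
    induction t with
    | zero => rfl
    | succ t ih =>
      rw [← ih]
      simp [config, Function.iterate_succ_apply', step]
  right_fixed t := by
    induction t with
    | zero => rfl
    | succ t ih =>
      rw [← ih]
      simp [config, Function.iterate_succ_apply', step]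
  move t i ha hb := by
    simp [config, Function.iterate_succ_apply', step, ha, hb]

/-! ### Persistence of visibility and convergence of every robot. -/

namespace IsTrajectory

variable {X : ℕ → ι → ℝ}

theorem shift (h : IsTrajectory V a b X) (T : ℕ) : IsTrajectory V a b fun t => X (T + t) where
  pos := h.pos
  left_fixed t := by rw [h.left_fixed, h.left_fixed (T + 0)]
  right_fixed t := by rw [h.right_fixed, h.right_fixed (T + 0)]
  move t i ha hb := h.move (T + t) i ha hb

/-- The reflected execution swaps the roles of `a` and `b`; every one-sided result below yields its
mirror image through this symmetry. -/
theorem neg (h : IsTrajectory V a b X) : IsTrajectory V b a fun t => -X t where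
  pos := h.pos
  left_fixed t := by simp [h.right_fixed t]
  right_fixed t := by simp [h.left_fixed t]
  move t i hb ha := by
    simp only [Pi.neg_apply, h.move t i ha hb, leftmost_neg, rightmost_neg]
    ring

variable [Finite ι]

theorem le_succ (h : IsTrajectory V a b X) {t : ℕ} {i j : ι} (hi : i ≠ a ∧ i ≠ b)
    (hj : j ≠ a ∧ j ≠ b) (hij : X t i ≤ X t j) : X (t + 1) i ≤ X (t + 1) j := by
  rw [h.move t i hi.1 hi.2, h.move t j hj.1 hj.2]
  linarith [leftmost_mono h.pos.le hij, rightmost_mono h.pos.le hij]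

theorem le_of_le (h : IsTrajectory V a b X) {s t : ℕ} (hst : s ≤ t) {i j : ι} (hi : i ≠ a ∧ i ≠ b)
    (hj : j ≠ a ∧ j ≠ b) (hij : X s i ≤ X s j) : X t i ≤ X t j := by
  induction t, hst using Nat.le_induction with
  | base => exact hij
  | succ t _ ih => exact h.le_succ hi hj ih

theorem visible_succ_of_fixed (h : IsTrajectory V a b X) {t : ℕ} {i j : ι} (hi : i ≠ a ∧ i ≠ b)
    (hj : X (t + 1) j = X t j) (hij : Visible V (X t) i j) : Visible V (X (t + 1)) i j := by
  have h1 := sub_le_leftmost h.pos.le (X t) i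
  have h2 := rightmost_le_add h.pos.le (X t) i
  have h3 := leftmost_le hij
  have h4 := le_rightmost hij
  have h5 := abs_le.1 hij
  unfold Visible
  rw [hj, h.move t i hi.1 hi.2, abs_le]
  constructor <;> linarith

/-- For two moving robots, each new position lies within `V / 2` of the midpoint of the two old
ones: one extreme robot is at least as far as the partner, the other at distance at most `V`. -/
theorem visible_succ (h : IsTrajectory V a b X) {t : ℕ} {i j : ι}
    (hij : Visible V (X t) i j) : Visible V (X (t + 1)) i j := by
  have fixed : ∀ k, ¬(k ≠ a ∧ k ≠ b) → X (t + 1) k = X t k := by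
    intro k hk
    rcases not_and_or.1 hk with hk | hk <;> rw [not_not] at hk <;> subst hk
    · rw [h.left_fixed, h.left_fixed t]
    · rw [h.right_fixed, h.right_fixed t]
  by_cases hi : i ≠ a ∧ i ≠ b <;> by_cases hj : j ≠ a ∧ j ≠ b
  · have h1 := sub_le_leftmost h.pos.le (X t) i
    have h2 := rightmost_le_add h.pos.le (X t) i
    have h3 := leftmost_le hij
    have h4 := le_rightmost hij
    have h1' := sub_le_leftmost h.pos.le (X t) j
    have h2' := rightmost_le_add h.pos.le (X t) j
    have h3' := leftmost_le hij.symm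
    have h4' := le_rightmost hij.symm
    unfold Visible
    rw [h.move t i hi.1 hi.2, h.move t j hj.1 hj.2, abs_le]
    constructor <;> linarith
  · exact h.visible_succ_of_fixed hi (fixed j hj) hij
  · exact (h.visible_succ_of_fixed hj (fixed i hi) hij.symm).symm
  · unfold Visible
    rwa [fixed i hi, fixed j hj]

theorem visible_of_le (h : IsTrajectory V a b X) {s t : ℕ} (hst : s ≤ t) {i j : ι}
    (hij : Visible V (X s) i j) : Visible V (X t) i j := by
  induction t, hst using Nat.le_induction with
  | base => exact hij
  | succ t _ ih => exact h.visible_succ ih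

/-- Visibility is eventually constant, since it is never lost. -/
theorem exists_visible_iff (h : IsTrajectory V a b X) :
    ∃ T, ∀ t ≥ T, ∀ i j, Visible V (X t) i j ↔ Visible V (X T) i j := by
  have key : ∀ᶠ s in atTop, ∀ q : ι × ι, ∀ t ≥ s,
      Visible V (X t) q.1 q.2 → Visible V (X s) q.1 q.2 := by
    refine eventually_all.2 fun q => ?_
    by_cases hq : ∃ s, Visible V (X s) q.1 q.2
    · obtain ⟨s, hs⟩ := hq
      filter_upwards [eventually_ge_atTop s] with s' hs' t _ _
      exact h.visible_of_le hs' hs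
    · push Not at hq
      exact Eventually.of_forall fun s t _ ht => absurd ht (hq t)
  obtain ⟨T, hT⟩ := key.exists
  exact ⟨T, fun t ht i j => ⟨hT (i, j) t ht, h.visible_of_le ht⟩⟩

theorem exists_bound (h : IsTrajectory V a b X) : ∃ m M, ∀ t i, X t i ∈ Set.Icc m M := by
  obtain ⟨m, hm⟩ := (Set.finite_range (X 0)).bddBelow
  obtain ⟨M, hM⟩ := (Set.finite_range (X 0)).bddAbove
  refine ⟨m, M, fun t => ?_⟩
  induction t with
  | zero => exact fun i => ⟨hm ⟨i, rfl⟩, hM ⟨i, rfl⟩⟩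
  | succ t ih =>
    intro i
    by_cases ha : i = a
    · rw [ha, h.left_fixed]
      exact ⟨hm ⟨a, rfl⟩, hM ⟨a, rfl⟩⟩
    by_cases hb : i = b
    · rw [hb, h.right_fixed]
      exact ⟨hm ⟨b, rfl⟩, hM ⟨b, rfl⟩⟩
    obtain ⟨l, -, hl⟩ := exists_leftmost h.pos.le (X t) i
    obtain ⟨r, -, hr⟩ := exists_rightmost h.pos.le (X t) i
    rw [h.move t i ha hb, hl, hr]
    constructor
    · linarith [(ih l).1, (ih r).1]
    · linarith [(ih l).2, (ih r).2]

theorem isBoundedUnder (h : IsTrajectory V a b X) (i : ι) :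
    IsBoundedUnder (· ≤ ·) atTop (fun t => X t i) ∧
      IsBoundedUnder (· ≥ ·) atTop (fun t => X t i) := by
  obtain ⟨m, M, hb⟩ := h.exists_bound
  exact ⟨⟨M, eventually_map.2 <| Eventually.of_forall fun t => (hb t i).2⟩,
    ⟨m, eventually_map.2 <| Eventually.of_forall fun t => (hb t i).1⟩⟩

/-- The leftmost visible position is at most that of `j`, and the rightmost one is eventually at
most the largest visible upper limit plus a small error. The witness `k` attains that largest upper
limit. -/
theorem two_mul_limsup_le (h : IsTrajectory V a b X)
    (hvis : ∀ t i j, Visible V (X t) i j ↔ Visible V (X 0) i j) {i j : ι}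
    (hi : i ≠ a ∧ i ≠ b) (hij : Visible V (X 0) i j) :
    ∃ k, Visible V (X 0) i k ∧
      2 * limsup (fun t => X t i) atTop ≤
        limsup (fun t => X t j) atTop + limsup (fun t => X t k) atTop := by
  set u : ι → ℝ := fun i => limsup (fun t => X t i) atTop with hu
  obtain ⟨k, hk, hmax⟩ := Set.exists_max_image {k | Visible V (X 0) i k} u (Set.toFinite _)
    ⟨i, visible_self h.pos.le _ i⟩
  refine ⟨k, hk, ?_⟩
  change 2 * u i ≤ u j + u k
  refine le_of_forall_pos_le_add fun ε hε => ?_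
  have hev : ∀ᶠ t in atTop, ∀ l, X t l < u l + ε / 2 := by
    refine eventually_all.2 fun l => ?_
    exact eventually_lt_of_limsup_lt (by simp only [hu]; linarith) (h.isBoundedUnder l).1
  have hle : u i ≤ (u j + u k + ε) / 2 := by
    have hs : u i = limsup (fun t => X (t + 1) i) atTop :=
      (limsup_nat_add (fun t => X t i) 1).symm
    rw [hs]
    refine limsup_le_of_le ?_ ?_
    · obtain ⟨m, M, hb⟩ := h.exists_bound
      exact IsBoundedUnder.isCoboundedUnder_le
        ⟨m, eventually_map.2 <| Eventually.of_forall fun t => (hb (t + 1) i).1⟩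
    · filter_upwards [hev] with t ht
      obtain ⟨r, hr, hr'⟩ := exists_rightmost h.pos.le (X t) i
      rw [h.move t i hi.1 hi.2, hr']
      have h1 := leftmost_le ((hvis t i j).2 hij)
      have h2 := hmax r ((hvis t i r).1 hr)
      linarith [ht j, ht r]
  linarith

/-- The sum in the hypothesis is the oscillation; writing minus the liminf as the limsup of `-X`
lets `neg` supply the inequalities for it. -/
theorem tendsto_limsup (h : IsTrajectory V a b X) {i : ι}
    (hi : limsup (fun t => X t i) atTop + limsup (fun t => -X t i) atTop ≤ 0) :
    Tendsto (fun t => X t i) atTop (𝓝 (limsup (fun t => X t i) atTop)) := by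
  rw [Metric.tendsto_nhds]
  intro ε hε
  have h1 := eventually_lt_of_limsup_lt
    (show limsup (fun t => X t i) atTop < limsup (fun t => X t i) atTop + ε by linarith)
    (h.isBoundedUnder i).1
  have h2 := eventually_lt_of_limsup_lt
    (show limsup (fun t => -X t i) atTop < limsup (fun t => -X t i) atTop + ε by linarith)
    (h.neg.isBoundedUnder i).1
  filter_upwards [h1, h2] with t ht1 ht2
  rw [Real.dist_eq, abs_lt]
  constructor <;> linarith

theorem limsup_add_limsup_neg {u : ℕ → ℝ} {c : ℝ} (hu : Tendsto u atTop (𝓝 c)) :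
    limsup u atTop + limsup (fun t => -u t) atTop = 0 := by
  rw [hu.limsup_eq, hu.neg.limsup_eq, add_neg_cancel]

/-- Every robot converges once visibility is constant: the upper and the lower limits are a sub- and
a super-infinity-harmonic function on the visibility graph, so the comparison principle applies. -/
theorem exists_tendsto_of_visible_iff (h : IsTrajectory V a b X)
    (hvis : ∀ t i j, Visible V (X t) i j ↔ Visible V (X 0) i j) (i : ι) :
    ∃ c, Tendsto (fun t => X t i) atTop (𝓝 c) := by
  refine ⟨_, h.tendsto_limsup ?_⟩
  set u : ι → ℝ := fun i => limsup (fun t => X t i) atTop with hu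
  set w : ι → ℝ := fun i => limsup (fun t => -X t i) atTop with hw
  have : Nonempty ι := ⟨i⟩
  obtain ⟨e, he⟩ := Finite.exists_max fun i => u i + w i
  refine (he i).trans ?_
  by_contra! hpos
  -- Among the robots of maximal, positive oscillation, keep those with the largest upper limit.
  -- They form a set `F` without crashed robots that turns out to be closed under visibility.
  obtain ⟨f, hf, hfmax⟩ := Set.exists_max_image {i | u i + w i = u e + w e} u (Set.toFinite _)
    ⟨e, rfl⟩
  set F : Set ι := {i | u i + w i = u e + w e ∧ u i = u f} with hF
  have crashed : ∀ i ∈ F, i ≠ a ∧ i ≠ b := by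
    intro i hi
    have hc : ∀ c, Tendsto (fun t => X t i) atTop (𝓝 c) → False := fun c hc => by
      have := limsup_add_limsup_neg hc
      have := hi.1
      simp only [hu, hw] at *
      linarith
    constructor
    · rintro rfl
      exact hc (X 0 i) (tendsto_const_nhds.congr fun t => (h.left_fixed t).symm)
    · rintro rfl
      exact hc (X 0 i) (tendsto_const_nhds.congr fun t => (h.right_fixed t).symm)
  have closed : ∀ i ∈ F, ∀ j, Visible V (X 0) i j → j ∈ F := by
    intro i hi
    have hi' := crashed i hi
    have sub : ∀ j, Visible V (X 0) i j → ∃ k, Visible V (X 0) i k ∧ 2 * u i ≤ u j + u k :=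
      fun j hj => h.two_mul_limsup_le hvis hi' hj
    have sup : ∀ j, Visible V (X 0) i j → ∃ k, Visible V (X 0) i k ∧ 2 * w i ≤ w j + w k := by
      intro j hj
      obtain ⟨k, hk, hk'⟩ := h.neg.two_mul_limsup_le (i := i) (j := j)
        (fun t i j => by rw [visible_neg, visible_neg, hvis]) hi'.symm (visible_neg.2 hj)
      exact ⟨k, visible_neg.1 hk, hk'⟩
    -- Adding `2 * w i ≤ w k + w l` and `2 * u i ≤ u l + u r ≤ u l + u k` shows that `k` too has
    -- maximal oscillation; hence no robot visible from `i` has an upper limit above `u f`.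
    obtain ⟨k, hk, hmax⟩ := Set.exists_max_image {k | Visible V (X 0) i k} u (Set.toFinite _)
      ⟨i, visible_self h.pos.le _ i⟩
    obtain ⟨l, hl, hl'⟩ := sup k hk
    obtain ⟨r, hr, hr'⟩ := sub l hl
    have h1 := hmax r hr
    have h2 := he k
    have h3 := he l
    have h4 := hi.1
    have h5 := hi.2
    have hk2 : u k ≤ u f := hfmax k (show u k + w k = u e + w e by linarith)
    intro j hj
    obtain ⟨r', hr1, hr2⟩ := sub j hj
    have h6 := hmax r' hr1
    have h7 := hmax j hj
    have huj : u j = u f := by linarith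
    obtain ⟨s, hs1, hs2⟩ := sup j hj
    obtain ⟨s', hs1', hs2'⟩ := sub s hs1
    have h8 := hmax s' hs1'
    have h9 := he s
    have h10 := he j
    exact ⟨by linarith, huj⟩
  -- Robots of `F` see only `F` and keep their weak order, so the rightmost one can only move left.
  -- It therefore converges, against its positive oscillation.
  obtain ⟨r, hr, hrmax⟩ := Set.exists_max_image F (X 0) (Set.toFinite _) ⟨f, hf, rfl⟩
  have hanti : Antitone fun t => X t r := by
    refine antitone_nat_of_succ_le fun t => ?_
    obtain ⟨s, hs, hs'⟩ := exists_rightmost h.pos.le (X t) r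
    have hsF := closed r hr s ((hvis t r s).1 hs)
    have h1 := h.le_of_le (Nat.zero_le t) (crashed s hsF) (crashed r hr) (hrmax s hsF)
    have h2 := leftmost_le (visible_self h.pos.le (X t) r)
    rw [h.move t r (crashed r hr).1 (crashed r hr).2]
    linarith
  obtain ⟨m, M, hb⟩ := h.exists_bound
  have hlim := tendsto_atTop_ciInf hanti
    ⟨m, by rintro _ ⟨t, rfl⟩; exact (hb t r).1⟩
  have h1 := limsup_add_limsup_neg hlim
  have h2 := hr.1
  simp only [hu, hw] at *
  linarith

theorem exists_tendsto (h : IsTrajectory V a b X) (i : ι) :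
    ∃ c, Tendsto (fun t => X t i) atTop (𝓝 c) := by
  obtain ⟨T, hT⟩ := h.exists_visible_iff
  obtain ⟨c, hc⟩ := (h.shift T).exists_tendsto_of_visible_iff
    (fun t i j => hT (T + t) (Nat.le_add_right T t) i j) i
  refine ⟨c, (tendsto_add_atTop_iff_nat T).1 (hc.congr fun t => ?_)⟩
  rw [add_comm]

end IsTrajectory

end Robots

/-! ### The limit configuration under constant connected visibility. -/

namespace Robots

variable {ι : Type*} {V : ℝ} {a b : ι} {X : ℕ → ι → ℝ} {P : ι → ℝ}

/-- A trajectory with limit configuration `P`, constant connected visibility, and the property that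
robots with different limits are always ordered like their limits. -/
structure IsSettled (V : ℝ) (a b : ι) (X : ℕ → ι → ℝ) (P : ι → ℝ) : Prop
    extends IsTrajectory V a b X where
  limit_lt : P a < P b
  tendsto : ∀ i, Tendsto (fun t => X t i) atTop (𝓝 (P i))
  visible_iff : ∀ t i j, Visible V (X t) i j ↔ Visible V (X 0) i j
  lt_of_limit_lt : ∀ t i j, P i < P j → X t i < X t j
  mem_of_closed : ∀ A : Set ι, A.Nonempty →
    (∀ i ∈ A, ∀ j, Visible V (X 0) i j → j ∈ A) → ∀ i, i ∈ A

namespace IsSettled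

theorem neg (h : IsSettled V a b X P) : IsSettled V b a (fun t => -X t) (-P) where
  toIsTrajectory := h.toIsTrajectory.neg
  limit_lt := by simpa using h.limit_lt
  tendsto i := (h.tendsto i).neg
  visible_iff t i j := by rw [visible_neg, visible_neg, h.visible_iff]
  lt_of_limit_lt t i j hij := by simpa using h.lt_of_limit_lt t j i (by simpa using hij)
  mem_of_closed A hA hcl := h.mem_of_closed A hA fun i hi j hj => hcl i hi j (visible_neg.2 hj)

theorem left_eq (h : IsSettled V a b X P) (t : ℕ) : X t a = P a := by
  refine tendsto_nhds_unique (tendsto_const_nhds.congr fun s => ?_) (h.tendsto a)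
  rw [h.left_fixed, h.left_fixed s]

theorem right_eq (h : IsSettled V a b X P) (t : ℕ) : X t b = P b := by
  simpa using h.neg.left_eq t

theorem abs_sub_le (h : IsSettled V a b X P) {i j : ι} (hij : Visible V (X 0) i j) :
    |P i - P j| ≤ V :=
  le_of_tendsto ((h.tendsto i).sub (h.tendsto j)).abs
    (Eventually.of_forall fun t => (h.visible_iff t i j).2 hij)

theorem visible_of_abs_sub_lt (h : IsSettled V a b X P) {i j : ι} (hij : |P i - P j| < V) :
    Visible V (X 0) i j := by
  obtain ⟨t, ht⟩ :=
    ((((h.tendsto i).sub (h.tendsto j)).abs.eventually_lt_const hij).exists)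
  exact (h.visible_iff t i j).1 ht.le

/-- Robots with the same limit, all of whose limit gaps are smaller than the visibility radius, see
the same robots and hence merge. -/
theorem succ_eq_of_limit_eq (h : IsSettled V a b X P) {i j : ι} (hi : i ≠ a ∧ i ≠ b)
    (hj : j ≠ a ∧ j ≠ b) (hij : P i = P j)
    (hi' : ∀ k, Visible V (X 0) i k → |P i - P k| < V)
    (hj' : ∀ k, Visible V (X 0) j k → |P j - P k| < V) (t : ℕ) :
    X (t + 1) i = X (t + 1) j := by
  have hset : {k | Visible V (X t) i k} = {k | Visible V (X t) j k} := by
    ext k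
    simp only [Set.mem_ofPred_eq, h.visible_iff t]
    exact ⟨fun hk => h.visible_of_abs_sub_lt (hij ▸ hi' k hk),
      fun hk => h.visible_of_abs_sub_lt (hij ▸ hj' k hk)⟩
  rw [h.move t i hi.1 hi.2, h.move t j hj.1 hj.2, leftmost, rightmost, hset]
  rfl

variable [Finite ι]

theorem tendsto_leftmost (h : IsSettled V a b X P) {i l : ι} (hl : Visible V (X 0) i l)
    (hmin : ∀ j, Visible V (X 0) i j → P l ≤ P j) :
    Tendsto (fun t => leftmost V (X t) i) atTop (𝓝 (P l)) := by
  rw [Metric.tendsto_nhds]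
  intro ε hε
  have hev : ∀ᶠ t in atTop, ∀ j, dist (X t j) (P j) < ε :=
    eventually_all.2 fun j => Metric.tendsto_nhds.1 (h.tendsto j) ε hε
  filter_upwards [hev] with t ht
  obtain ⟨k, hk, hk'⟩ := exists_leftmost h.pos.le (X t) i
  have h1 := leftmost_le ((h.visible_iff t i l).2 hl)
  have h2 := hmin k ((h.visible_iff t i k).1 hk)
  have h3 := abs_lt.1 (ht k)
  have h4 := abs_lt.1 (ht l)
  rw [Real.dist_eq, abs_lt]
  constructor <;> linarith [h3.1, h4.2]

theorem tendsto_rightmost (h : IsSettled V a b X P) {i r : ι} (hr : Visible V (X 0) i r)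
    (hmax : ∀ j, Visible V (X 0) i j → P j ≤ P r) :
    Tendsto (fun t => rightmost V (X t) i) atTop (𝓝 (P r)) := by
  have := (h.neg.tendsto_leftmost (visible_neg.2 hr)
    fun j hj => neg_le_neg (hmax j (visible_neg.1 hj))).neg
  simpa [leftmost_neg] using this

/-- The limit configuration is infinity-harmonic on the visibility graph. -/
theorem exists_harmonic (h : IsSettled V a b X P) {i : ι} (hi : i ≠ a ∧ i ≠ b) :
    ∃ l r, Visible V (X 0) i l ∧ Visible V (X 0) i r ∧
      (∀ j, Visible V (X 0) i j → P l ≤ P j ∧ P j ≤ P r) ∧ 2 * P i = P l + P r := by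
  have hne : {j | Visible V (X 0) i j}.Nonempty := ⟨i, visible_self h.pos.le _ i⟩
  obtain ⟨l, hl, hmin⟩ := Set.exists_min_image _ P (Set.toFinite _) hne
  obtain ⟨r, hr, hmax⟩ := Set.exists_max_image _ P (Set.toFinite _) hne
  refine ⟨l, r, hl, hr, fun j hj => ⟨hmin j hj, hmax j hj⟩, ?_⟩
  have h1 := ((h.tendsto_leftmost hl hmin).add (h.tendsto_rightmost hr hmax)).div_const 2
  have h2 := tendsto_nhds_unique
    (((tendsto_add_atTop_iff_nat 1).2 (h.tendsto i)).congr fun t => h.move t i hi.1 hi.2) h1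
  linarith

/-- Minimum principle: if the minimum of `P` were below `P a`, the midpoint property would spread it
to the whole connected graph, including `a`. -/
theorem left_le_limit (h : IsSettled V a b X P) (i : ι) : P a ≤ P i := by
  have : Nonempty ι := ⟨i⟩
  obtain ⟨e, he⟩ := Finite.exists_min P
  refine le_trans ?_ (he i)
  by_contra! hlt
  have hmem := h.mem_of_closed {i | P i = P e} ⟨e, rfl⟩ ?_ a
  · exact hlt.ne' hmem
  intro i hi j hj
  have hi' : P i = P e := hi
  have hne : i ≠ a ∧ i ≠ b := by
    constructor
    · rintro rfl; exact hlt.ne' hi'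
    · rintro rfl; linarith [h.limit_lt]
  obtain ⟨l, r, -, -, hlr, heq⟩ := h.exists_harmonic hne
  have h1 := he l
  have h2 := he j
  have h3 := hlr j hj
  change P j = P e
  linarith [hlr i (visible_self h.pos.le _ i)]

theorem limit_eq_left_of_visible (h : IsSettled V a b X P) {i j : ι} (hi : i ≠ a ∧ i ≠ b)
    (hPi : P i = P a) (hij : Visible V (X 0) i j) : P j = P a := by
  obtain ⟨l, r, -, -, hlr, heq⟩ := h.exists_harmonic hi
  have h1 := h.left_le_limit l
  have h2 := h.left_le_limit j
  have h3 := hlr j hij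
  linarith [hlr i (visible_self h.pos.le _ i)]

/-- Otherwise the robots with limit `P a` would be closed under visibility and would include `b`. -/
theorem exists_visible_left_lt (h : IsSettled V a b X P) :
    ∃ j, Visible V (X 0) a j ∧ P a < P j := by
  by_contra! hc
  have hmem := h.mem_of_closed {i | P i = P a} ⟨a, rfl⟩ ?_ b
  · exact h.limit_lt.ne' hmem
  intro i hi j hj
  by_cases hia : i = a
  · subst hia
    exact (hc j hj).antisymm (h.left_le_limit j)
  · refine h.limit_eq_left_of_visible ⟨hia, ?_⟩ hi hj
    rintro rfl
    exact h.limit_lt.ne' hi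

/-- A robot that converges to a crashed robot approaches it from outside. -/
theorem lt_left_of_limit_eq (h : IsSettled V a b X P) {i : ι} (hi : i ≠ a ∧ i ≠ b)
    (hPi : P i = P a) (t : ℕ) : X t i < X t a := by
  by_contra! hle
  obtain ⟨j, hj, hj'⟩ := h.exists_visible_left_lt
  have h1 := h.lt_of_limit_lt t i j (by rwa [hPi])
  have h2 := abs_le.1 ((h.visible_iff t a j).2 hj)
  have h3 : Visible V (X t) i j := abs_le.2 ⟨by linarith [h2.1], by linarith [h.pos]⟩
  exact hj'.ne' (h.limit_eq_left_of_visible hi hPi ((h.visible_iff t i j).1 h3))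

theorem ne_of_lt_left (h : IsSettled V a b X P) {t : ℕ} {i : ι} (hi : X t i < X t a) :
    (i ≠ a ∧ i ≠ b) ∧ P i = P a := by
  refine ⟨⟨?_, ?_⟩, ?_⟩
  · rintro rfl; exact hi.false
  · rintro rfl; exact (h.lt_of_limit_lt t _ _ h.limit_lt).not_gt hi
  · exact ((h.left_le_limit i).lt_or_eq.resolve_left
      fun hlt => (h.lt_of_limit_lt t _ _ hlt).not_gt hi).symm

theorem ne_of_right_lt (h : IsSettled V a b X P) {t : ℕ} {i : ι} (hi : X t b < X t i) :
    (i ≠ a ∧ i ≠ b) ∧ P i = P b := by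
  have := h.neg.ne_of_lt_left (t := t) (i := i) (by simpa using hi)
  exact ⟨this.1.symm, by simpa using this.2⟩

/-- Left outsiders see only robots with limit `P a`, so all their limit gaps vanish and one round
merges them. -/
theorem left_unique (h : IsSettled V a b X P) {t : ℕ} {i j : ι} (hi : X (t + 1) i < X (t + 1) a)
    (hj : X (t + 1) j < X (t + 1) a) : X (t + 1) i = X (t + 1) j := by
  obtain ⟨hi, hi'⟩ := h.ne_of_lt_left hi
  obtain ⟨hj, hj'⟩ := h.ne_of_lt_left hj
  refine h.succ_eq_of_limit_eq hi hj (hi'.trans hj'.symm) ?_ ?_ t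
  · intro k hk
    rw [hi', h.limit_eq_left_of_visible hi hi' hk]
    simpa using h.pos
  · intro k hk
    rw [hj', h.limit_eq_left_of_visible hj hj' hk]
    simpa using h.pos

theorem right_unique (h : IsSettled V a b X P) {t : ℕ} {i j : ι}
    (hi : X (t + 1) b < X (t + 1) i) (hj : X (t + 1) b < X (t + 1) j) :
    X (t + 1) i = X (t + 1) j := by
  simpa using h.neg.left_unique (t := t) (i := i) (j := j) (by simpa using hi) (by simpa using hj)

/-- Time does not occur on the right: this and the next three equivalences freeze the order relative
to the crashed robots, to which `le_succ` does not apply. -/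
theorem left_lt_iff (h : IsSettled V a b X P) (i : ι) (t : ℕ) : X t a < X t i ↔ P a < P i := by
  refine ⟨fun hlt => (h.left_le_limit i).lt_of_ne fun heq => ?_, h.lt_of_limit_lt t a i⟩
  by_cases hia : i = a
  · subst hia; exact hlt.false
  refine (h.lt_left_of_limit_eq ⟨hia, ?_⟩ heq.symm t).not_gt hlt
  rintro rfl
  exact h.limit_lt.ne heq

theorem lt_left_iff (h : IsSettled V a b X P) (i : ι) (t : ℕ) :
    X t i < X t a ↔ i ≠ a ∧ P i = P a := by
  refine ⟨fun hlt => ⟨(h.ne_of_lt_left hlt).1.1, (h.ne_of_lt_left hlt).2⟩, fun hi => ?_⟩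
  refine h.lt_left_of_limit_eq ⟨hi.1, ?_⟩ hi.2 t
  rintro rfl
  exact h.limit_lt.ne' hi.2

theorem lt_right_iff (h : IsSettled V a b X P) (i : ι) (t : ℕ) : X t i < X t b ↔ P i < P b := by
  simpa using h.neg.left_lt_iff i t

theorem right_lt_iff (h : IsSettled V a b X P) (i : ι) (t : ℕ) :
    X t b < X t i ↔ i ≠ b ∧ P i = P b := by
  simpa using h.neg.lt_left_iff i t

end IsSettled

theorem mem_of_closed_of_connected {p : ι → ℝ} (hc : (visibilityGraph V p).Connected) (A : Set ι)
    (hA : A.Nonempty) (hcl : ∀ i ∈ A, ∀ j, Visible V p i j → j ∈ A) (i : ι) : i ∈ A := by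
  obtain ⟨e, he⟩ := hA
  have hr := (SimpleGraph.reachable_iff_reflTransGen e i).1 (hc.preconnected e i)
  induction hr with
  | refl => exact he
  | tail _ hadj ih => exact hcl _ ih _ hadj.2

/-! ### Existence of a size-stable time. -/

namespace IsTrajectory

variable [Finite ι]

/-- Weak order between non-faulty robots is never reversed, so a strict inequality that fails once
fails forever. -/
theorem eventually_order (h : IsTrajectory V a b X) :
    ∀ᶠ s in atTop, ∀ t ≥ s, ∀ i j, (i ≠ a ∧ i ≠ b) → (j ≠ a ∧ j ≠ b) →
      (X (t + 1) i < X (t + 1) j ↔ X t i < X t j) := by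
  have key : ∀ᶠ t in atTop, ∀ q : ι × ι, (q.1 ≠ a ∧ q.1 ≠ b) → (q.2 ≠ a ∧ q.2 ≠ b) →
      X t q.1 < X t q.2 → X (t + 1) q.1 < X (t + 1) q.2 := by
    refine eventually_all.2 fun q => ?_
    by_cases hq : ∃ s, X s q.2 ≤ X s q.1
    · obtain ⟨s, hs⟩ := hq
      filter_upwards [eventually_ge_atTop s] with t ht h1 h2 hlt
      exact absurd hlt (h.le_of_le ht h2 h1 hs).not_gt
    · push Not at hq
      exact Eventually.of_forall fun t _ _ _ => hq (t + 1)
  filter_upwards [eventually_forall_ge_atTop.2 key] with s hs t ht i j hi hj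
  refine ⟨fun hlt => ?_, hs t ht (i, j) hi hj⟩
  by_contra! hle
  exact (h.le_succ hj hi hle).not_gt hlt

theorem exists_isSizeStable (h : IsTrajectory V a b X) (hlt : X 0 a < X 0 b)
    (hlim : ∀ i, Tendsto (fun t => X t i) atTop (𝓝 (P i)))
    (hc : (visibilityGraph V (X 0)).Connected) : ∃ T, IsSizeStable V a b X T := by
  have hPa : P a = X 0 a :=
    tendsto_nhds_unique (hlim a) (tendsto_const_nhds.congr fun t => (h.left_fixed t).symm)
  have hPb : P b = X 0 b :=
    tendsto_nhds_unique (hlim b) (tendsto_const_nhds.congr fun t => (h.right_fixed t).symm)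
  have hord : ∀ᶠ t in atTop, ∀ q : ι × ι, P q.1 < P q.2 → X t q.1 < X t q.2 :=
    eventually_all.2 fun q => by
      by_cases hq : P q.1 < P q.2
      · filter_upwards [(hlim q.1).eventually_lt (hlim q.2) hq] with t ht _ using ht
      · exact Eventually.of_forall fun t hq' => absurd hq' hq
  obtain ⟨T₁, hT₁⟩ := h.exists_visible_iff
  obtain ⟨T, hT, hTord, hTP⟩ := ((eventually_ge_atTop T₁).and
    (h.eventually_order.and (eventually_forall_ge_atTop.2 hord))).exists
  have hs : IsSettled V a b (fun t => X (T + t)) P :=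
    { toIsTrajectory := h.shift T
      limit_lt := by rwa [hPa, hPb]
      tendsto := fun i => ((tendsto_add_atTop_iff_nat T).2 (hlim i)).congr fun t => by
        rw [add_comm]
      visible_iff := fun t i j => by
        rw [hT₁ (T + t) (by omega), hT₁ (T + 0) (by omega)]
      lt_of_limit_lt := fun t i j hij => hTP (T + t) (by omega) (i, j) hij
      mem_of_closed := fun A hA hcl => mem_of_closed_of_connected hc A hA fun i hi j hij =>
        hcl i hi j (h.visible_of_le (Nat.zero_le _) hij) }
  have hTadd : ∀ t ≥ T + 1, ∃ s, t = T + (s + 1) := fun t ht => ⟨t - (T + 1), by omega⟩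
  -- The extra round is the one in which the outsiders on each side merge.
  refine ⟨T + 1, ?_, ?_, ?_, ?_, ?_, ?_⟩
  · intro t ht i j hij
    rw [hT₁ t (by omega)]
    rwa [hT₁ (t + 1) (by omega)] at hij
  · intro t ht i j
    obtain ⟨s, rfl⟩ := hTadd t ht
    have e1 := hs.left_lt_iff
    have e2 := hs.lt_left_iff
    have e3 := hs.right_lt_iff
    have e4 := hs.lt_right_iff
    by_cases hia : i = a
    · subst hia
      exact (e1 j (s + 2)).trans (e1 j (s + 1)).symm
    by_cases hja : j = a
    · subst hja
      exact (e2 i (s + 2)).trans (e2 i (s + 1)).symm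
    by_cases hib : i = b
    · subst hib
      exact (e3 j (s + 2)).trans (e3 j (s + 1)).symm
    by_cases hjb : j = b
    · subst hjb
      exact (e4 i (s + 2)).trans (e4 i (s + 1)).symm
    exact hTord _ (by omega) i j ⟨hia, hib⟩ ⟨hja, hjb⟩
  · intro t ht i j hi hj
    obtain ⟨s, rfl⟩ := hTadd t ht
    exact hs.left_unique hi hj
  · intro t ht i j hi hj
    obtain ⟨s, rfl⟩ := hTadd t ht
    exact hs.right_unique hi hj
  · intro i hi
    rw [h.left_fixed, ← hPa, ← (hs.ne_of_lt_left (t := 1) hi).2]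
    exact hlim i
  · intro i hi
    rw [h.right_fixed, ← hPb, ← (hs.ne_of_right_lt (t := 1) hi).2]
    exact hlim i

end IsTrajectory

end Robots

/-! ### Constant order: merging, limit gaps and the primary chain. -/

namespace Robots

variable {ι : Type*} {V : ℝ} {a b : ι} {X : ℕ → ι → ℝ} {P : ι → ℝ} {lam rho : ι → ι}

/-- Serves to follow `rho` to the right, a step that strictly increases `P`. -/
theorem descending_induction [Finite ι] (f : ι → ℝ) {C : ι → Prop}
    (step : ∀ i, (∀ j, f i < f j → C j) → C i) (i : ι) : C i := by
  by_contra hi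
  obtain ⟨e, he, hmax⟩ := Set.exists_max_image {i | ¬C i} f (Set.toFinite _) ⟨i, hi⟩
  refine he (step e fun j hj => ?_)
  by_contra hCj
  exact (hmax j hCj).not_gt hj

/-- A settled trajectory with constant relative order, in which `lam i` and `rho i` are a leftmost
and a rightmost robot visible from `i`. -/
structure IsOrdered (V : ℝ) (a b : ι) (X : ℕ → ι → ℝ) (P : ι → ℝ) (lam rho : ι → ι) : Prop
    extends IsSettled V a b X P where
  lt_iff : ∀ t i j, X t i < X t j ↔ X 0 i < X 0 j
  visible_lam : ∀ i, Visible V (X 0) i (lam i)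
  visible_rho : ∀ i, Visible V (X 0) i (rho i)
  leftmost_eq : ∀ t i, leftmost V (X t) i = X t (lam i)
  rightmost_eq : ∀ t i, rightmost V (X t) i = X t (rho i)

namespace IsSettled

variable [Finite ι]

theorem exists_isOrdered (h : IsSettled V a b X P)
    (hlt : ∀ t i j, X t i < X t j ↔ X 0 i < X 0 j) :
    ∃ lam rho, IsOrdered V a b X P lam rho := by
  choose lam hlam hlam' using exists_leftmost h.pos.le (X 0)
  choose rho hrho hrho' using exists_rightmost h.pos.le (X 0)
  refine ⟨lam, rho, h, hlt, hlam, hrho, fun t i => ?_, fun t i => ?_⟩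
  · obtain ⟨l, hl, hl'⟩ := exists_leftmost h.pos.le (X t) i
    refine (leftmost_le ((h.visible_iff t _ _).2 (hlam i))).antisymm ?_
    rw [hl', ← not_lt, hlt, not_lt, ← hlam']
    exact leftmost_le ((h.visible_iff t _ _).1 hl)
  · obtain ⟨l, hl, hl'⟩ := exists_rightmost h.pos.le (X t) i
    refine le_antisymm ?_ (le_rightmost ((h.visible_iff t _ _).2 (hrho i)))
    rw [hl', ← not_lt, hlt, not_lt, ← hrho']
    exact le_rightmost ((h.visible_iff t _ _).1 hl)

end IsSettled

namespace IsOrdered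

theorem neg (h : IsOrdered V a b X P lam rho) :
    IsOrdered V b a (fun t => -X t) (-P) rho lam where
  toIsSettled := h.toIsSettled.neg
  lt_iff t i j := by simpa using h.lt_iff t j i
  visible_lam i := visible_neg.2 (h.visible_rho i)
  visible_rho i := visible_neg.2 (h.visible_lam i)
  leftmost_eq t i := by simp [leftmost_neg, h.rightmost_eq]
  rightmost_eq t i := by simp [rightmost_neg, h.leftmost_eq]

theorem le_iff (h : IsOrdered V a b X P lam rho) (t : ℕ) (i j : ι) :
    X t i ≤ X t j ↔ X 0 i ≤ X 0 j := by
  rw [← not_lt, h.lt_iff, not_lt]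

theorem eq_iff (h : IsOrdered V a b X P lam rho) (t : ℕ) (i j : ι) :
    X t i = X t j ↔ X 0 i = X 0 j := by
  rw [le_antisymm_iff, h.le_iff t i, h.le_iff t j, ← le_antisymm_iff]

theorem limit_le (h : IsOrdered V a b X P lam rho) {t : ℕ} {i j : ι} (hij : X t i ≤ X t j) :
    P i ≤ P j :=
  le_of_tendsto_of_tendsto' (h.tendsto i) (h.tendsto j)
    fun s => (h.le_iff s i j).2 ((h.le_iff t i j).1 hij)

theorem limit_eq (h : IsOrdered V a b X P lam rho) {t : ℕ} {i j : ι} (hij : X t i = X t j) :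
    P i = P j :=
  (h.limit_le hij.le).antisymm (h.limit_le hij.ge)

/-- The robots in the segment between the crashed robots. -/
def Inside (a b : ι) (X : ℕ → ι → ℝ) (i : ι) : Prop :=
  X 0 a ≤ X 0 i ∧ X 0 i ≤ X 0 b

theorem Inside.neg {i : ι} (hi : Inside a b X i) : Inside b a (fun t => -X t) i := by
  simpa [Inside, and_comm] using hi

theorem inside_left (h : IsOrdered V a b X P lam rho) : Inside a b X a :=
  ⟨le_rfl, (h.lt_of_limit_lt 0 _ _ h.limit_lt).le⟩

theorem inside_right (h : IsOrdered V a b X P lam rho) : Inside a b X b :=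
  ⟨(h.lt_of_limit_lt 0 _ _ h.limit_lt).le, le_rfl⟩

theorem two_mul_limit (h : IsOrdered V a b X P lam rho) {i : ι} (hi : i ≠ a ∧ i ≠ b) :
    2 * P i = P (lam i) + P (rho i) := by
  have h1 := ((h.tendsto (lam i)).add (h.tendsto (rho i))).div_const 2
  have h2 := tendsto_nhds_unique
    (((tendsto_add_atTop_iff_nat 1).2 (h.tendsto i)).congr fun t => by
      rw [h.move t i hi.1 hi.2, h.leftmost_eq, h.rightmost_eq]) h1
  linarith

variable [Finite ι]

theorem limit_le_rho (h : IsOrdered V a b X P lam rho) {i j : ι} (hij : Visible V (X 0) i j) :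
    P j ≤ P (rho i) :=
  h.limit_le (t := 0) (h.rightmost_eq 0 i ▸ le_rightmost hij)

theorem lam_limit_le (h : IsOrdered V a b X P lam rho) {i j : ι} (hij : Visible V (X 0) i j) :
    P (lam i) ≤ P j :=
  h.limit_le (t := 0) (h.leftmost_eq 0 i ▸ leftmost_le hij)

theorem eq_left_of_limit_eq (h : IsOrdered V a b X P lam rho) {i : ι} (hi : Inside a b X i)
    (hP : P i = P a) : i = a := by
  by_contra hia
  exact ((h.lt_left_iff i 0).2 ⟨hia, hP⟩).not_ge hi.1

theorem eq_right_of_limit_eq (h : IsOrdered V a b X P lam rho) {i : ι} (hi : Inside a b X i)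
    (hP : P i = P b) : i = b := by
  by_contra hib
  exact ((h.right_lt_iff i 0).2 ⟨hib, hP⟩).not_ge hi.2

/-- A right gap equal to `V` propagates along `rho` up to `b`, since gaps cannot shrink or exceed
`V`. As `b` sits at its limit and neighbours stay within `V`, the bound travels back from `b` to
`i`. -/
theorem le_of_limit_gap_eq (h : IsOrdered V a b X P lam rho) (t : ℕ) (i : ι) :
    P (rho i) - P i = V → P i ≤ X t i := by
  refine descending_induction P (C := fun i => P (rho i) - P i = V → P i ≤ X t i)
    (fun i ih hgap => ?_) i
  have hlt : P i < P (rho i) := by linarith [h.pos]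
  have hvis := (abs_le.1 ((h.visible_iff t _ _).2 (h.visible_rho i))).1
  suffices P (rho i) ≤ X t (rho i) by linarith
  by_cases hb : rho i = b
  · rw [hb, h.right_eq]
  have ha : rho i ≠ a := by
    intro ha
    rw [ha] at hlt
    exact (h.left_le_limit i).not_gt hlt
  refine ih _ hlt ?_
  have h1 := h.two_mul_limit ⟨ha, hb⟩
  have h2 := h.lam_limit_le (h.visible_rho i).symm
  have h3 := (abs_le.1 (h.abs_sub_le (h.visible_rho (rho i)))).1
  linarith

theorem eq_limit_of_gap_eq (h : IsOrdered V a b X P lam rho) {i : ι} (hi : i ≠ a ∧ i ≠ b)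
    (hgap : P (rho i) - P i = V) (t : ℕ) : X t i = P i := by
  refine le_antisymm ?_ (h.le_of_limit_gap_eq t i hgap)
  have h1 := h.neg.le_of_limit_gap_eq t i
  have h2 := h.two_mul_limit hi
  simpa using h1 (by simp only [Pi.neg_apply]; linarith)

/-- Both gaps of `i` equal `V`. If `j` is not to the right of `i`, it still sees `lam i`; otherwise
it sees `rho i`. One gap of `j` is thus `V`, and the midpoint property gives the other. -/
theorem gap_eq_of_limit_eq (h : IsOrdered V a b X P lam rho) {i j : ι} (hi : i ≠ a ∧ i ≠ b)
    (hj : j ≠ a ∧ j ≠ b) (hij : P i = P j) (hgap : P (rho i) - P i = V) :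
    P (rho j) - P j = V := by
  have hi' := h.two_mul_limit hi
  have hj' := h.two_mul_limit hj
  have hle := (abs_le.1 (h.abs_sub_le (h.visible_rho j))).1
  have hpos := h.pos
  rcases le_total (X 0 j) (X 0 i) with hle' | hle'
  · have h1 := (abs_le.1 (h.visible_lam i)).2
    have h2 := h.lt_of_limit_lt 0 (lam i) j (by linarith)
    have h3 : Visible V (X 0) j (lam i) := abs_le.2 ⟨by linarith, by linarith⟩
    have h4 := h.lam_limit_le h3
    linarith
  · have h1 := (abs_le.1 (h.visible_rho i)).1
    have h2 := h.lt_of_limit_lt 0 j (rho i) (by linarith)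
    have h3 : Visible V (X 0) j (rho i) := abs_le.2 ⟨by linarith, by linarith⟩
    have h4 := h.limit_le_rho h3
    linarith

/-- Non-faulty robots with the same limit have merged. -/
theorem eq_of_limit_eq (h : IsOrdered V a b X P lam rho) {i j : ι} (hi : i ≠ a ∧ i ≠ b)
    (hj : j ≠ a ∧ j ≠ b) (hij : P i = P j) (t : ℕ) : X t i = X t j := by
  by_cases hgap : P (rho i) - P i = V
  · rw [h.eq_limit_of_gap_eq hi hgap,
      h.eq_limit_of_gap_eq hj (h.gap_eq_of_limit_eq hi hj hij hgap), hij]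
  have small : ∀ k, k ≠ a ∧ k ≠ b → P (rho k) - P k ≠ V →
      ∀ l, Visible V (X 0) k l → |P k - P l| < V := by
    intro k hk hgap l hl
    have h1 := h.two_mul_limit hk
    have h2 := (abs_le.1 (h.abs_sub_le (h.visible_rho k))).1
    have h3 : P (rho k) - P k < V := lt_of_le_of_ne (by linarith) hgap
    have h4 := h.limit_le_rho hl
    have h5 := h.lam_limit_le hl
    rw [abs_lt]
    constructor <;> linarith
  have hgap' : P (rho j) - P j ≠ V := fun hg => hgap (h.gap_eq_of_limit_eq hj hi hij.symm hg)
  -- Equality after one round is equality at all times, because the order is constant.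
  have := h.succ_eq_of_limit_eq hi hj hij (small i hi hgap) (small j hj hgap') t
  rwa [h.eq_iff, ← h.eq_iff t] at this

theorem Inside.eq_of_limit_eq (h : IsOrdered V a b X P lam rho) {i j : ι} (hi : Inside a b X i)
    (hj : Inside a b X j) (hij : P i = P j) (t : ℕ) : X t i = X t j := by
  by_cases hia : i = a
  · rw [hia, h.eq_left_of_limit_eq hj (by rw [← hij, hia])]
  by_cases hib : i = b
  · rw [hib, h.eq_right_of_limit_eq hj (by rw [← hij, hib])]
  refine h.eq_of_limit_eq ⟨hia, hib⟩ ⟨?_, ?_⟩ hij t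
  · rintro rfl
    exact hia (h.eq_left_of_limit_eq hi hij)
  · rintro rfl
    exact hib (h.eq_right_of_limit_eq hi hij)

/-- A robot beyond `b` is seen only by robots with limit `P b`, and the only such robot in the
segment is `b`. -/
theorem inside_rho (h : IsOrdered V a b X P lam rho) {i : ι} (hi : Inside a b X i)
    (hib : i ≠ b) : Inside a b X (rho i) := by
  constructor
  · exact hi.1.trans (h.rightmost_eq 0 i ▸ le_rightmost (visible_self h.pos.le _ i))
  · by_contra! hlt
    obtain ⟨hne, hP⟩ := h.ne_of_right_lt hlt
    have := h.neg.limit_eq_left_of_visible hne.symm (by simpa using hP)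
      (visible_neg.2 (h.visible_rho i).symm)
    exact hib (h.eq_right_of_limit_eq hi (by simpa using this))

theorem inside_lam (h : IsOrdered V a b X P lam rho) {i : ι} (hi : Inside a b X i)
    (hia : i ≠ a) : Inside a b X (lam i) := by
  simpa using (h.neg.inside_rho hi.neg hia).neg

/-- With equality at a non-faulty robot, everything visible from it would share its limit. Robots
with that limit have merged and see the same, so the set would be closed under visibility without
containing `b`. -/
theorem limit_lt_rho (h : IsOrdered V a b X P lam rho) {i : ι} (hi : Inside a b X i)
    (hib : i ≠ b) : P i < P (rho i) := by
  by_cases hia : i = a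
  · subst hia
    obtain ⟨j, hj, hj'⟩ := h.exists_visible_left_lt
    exact hj'.trans_le (h.limit_le_rho hj)
  by_contra! hle
  have hPa : P i ≠ P a := fun hP => hia (h.eq_left_of_limit_eq hi hP)
  have hPb : P i ≠ P b := fun hP => hib (h.eq_right_of_limit_eq hi hP)
  refine hPb.symm (h.mem_of_closed {j | P j = P i} ⟨i, rfl⟩ (fun j hj k hk => ?_) b)
  have hj' : P j = P i := hj
  have hX : X 0 j = X 0 i := by
    refine h.eq_of_limit_eq ⟨?_, ?_⟩ ⟨hia, hib⟩ hj' 0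
    · rintro rfl; exact hPa hj'.symm
    · rintro rfl; exact hPb hj'.symm
  have hk' : Visible V (X 0) i k := by
    unfold Visible at *
    rwa [← hX]
  have h1 := h.limit_le_rho hk'
  have h2 := h.lam_limit_le hk'
  have h3 := h.two_mul_limit ⟨hia, hib⟩
  have h4 := h.limit_le_rho (visible_self h.pos.le (X 0) i)
  change P k = P i
  linarith

theorem lam_limit_lt (h : IsOrdered V a b X P lam rho) {i : ι} (hi : Inside a b X i)
    (hia : i ≠ a) : P (lam i) < P i := by
  simpa using h.neg.limit_lt_rho hi.neg hia

theorem rho_ne_left (h : IsOrdered V a b X P lam rho) {i : ι} (hi : Inside a b X i)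
    (hib : i ≠ b) : rho i ≠ a := by
  intro ha
  have h1 := h.limit_lt_rho hi hib
  rw [ha] at h1
  exact (h.left_le_limit i).not_gt h1

/-- Consecutive robots of a mutual chain. -/
def IsLink (V : ℝ) (p : ι → ℝ) (u v : ι) : Prop :=
  p u < p v ∧ rightmost V p u = p v ∧ leftmost V p v = p u

theorem isLink_rho (h : IsOrdered V a b X P lam rho) {i : ι} (hi : Inside a b X i) (hib : i ≠ b)
    (hle : P i ≤ P (lam (rho i))) (t : ℕ) : IsLink V (X t) i (rho i) := by
  refine ⟨h.lt_of_limit_lt t _ _ (h.limit_lt_rho hi hib), h.rightmost_eq t i, ?_⟩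
  rw [h.leftmost_eq]
  exact Inside.eq_of_limit_eq h (h.inside_lam (h.inside_rho hi hib) (h.rho_ne_left hi hib)) hi
    ((h.lam_limit_le (h.visible_rho i).symm).antisymm hle) t

/-- Right gaps do not decrease along `rho`, and the last one, into `b`, is at most the left gap of
`b`. -/
theorem gap_le_right_gap (h : IsOrdered V a b X P lam rho) (i : ι) :
    Inside a b X i → i ≠ b → P (rho i) - P i ≤ P b - P (lam b) := by
  refine descending_induction P
    (C := fun i => Inside a b X i → i ≠ b → P (rho i) - P i ≤ P b - P (lam b))
    (fun i ih hi hib => ?_) i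
  have hvis := h.lam_limit_le (h.visible_rho i).symm
  by_cases hb : rho i = b
  · rw [hb] at hvis ⊢
    linarith
  · have h1 := ih _ (h.limit_lt_rho hi hib) (h.inside_rho hi hib) hb
    have h2 := h.two_mul_limit ⟨h.rho_ne_left hi hib, hb⟩
    linarith

theorem right_gap_le_left_gap (h : IsOrdered V a b X P lam rho) :
    P b - P (lam b) ≤ P (rho a) - P a := by
  have := h.neg.gap_le_right_gap b h.inside_right.neg (by rintro rfl; exact h.limit_lt.false)
  simp only [Pi.neg_apply] at this
  linarith

/-- The gap hypothesis is the reverse of `gap_le_right_gap`, so equality holds; it passes to `rho i`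
and makes each link mutual. For `i = a` it is `right_gap_le_left_gap`. -/
theorem exists_primary_aux (h : IsOrdered V a b X P lam rho) (i : ι) :
    Inside a b X i → i ≠ b → P b - P (lam b) ≤ P (rho i) - P i →
      ∃ L : List ι, (∀ t, (i :: L).IsChain (IsLink V (X t))) ∧ (i :: L).getLast? = some b := by
  refine descending_induction P (C := fun i => Inside a b X i → i ≠ b →
    P b - P (lam b) ≤ P (rho i) - P i →
      ∃ L : List ι, (∀ t, (i :: L).IsChain (IsLink V (X t))) ∧ (i :: L).getLast? = some b)
    (fun i ih hi hib hgap => ?_) i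
  have hvis := h.lam_limit_le (h.visible_rho i).symm
  by_cases hb : rho i = b
  · refine ⟨[b], fun t => ?_, rfl⟩
    have := h.isLink_rho hi hib (by rw [hb] at hgap ⊢; linarith) t
    simpa [hb] using this
  · have h1 := h.gap_le_right_gap _ (h.inside_rho hi hib) hb
    have h2 := h.two_mul_limit ⟨h.rho_ne_left hi hib, hb⟩
    obtain ⟨L, hL, hlast⟩ := ih _ (h.limit_lt_rho hi hib) (h.inside_rho hi hib) hb (by linarith)
    refine ⟨rho i :: L, fun t => ?_, by simpa using hlast⟩
    exact List.isChain_cons_cons.2 ⟨h.isLink_rho hi hib (by linarith) t, hL t⟩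

theorem exists_primary (h : IsOrdered V a b X P lam rho) :
    ∃ L, ∀ t, IsPrimaryChain V a b (X t) L := by
  obtain ⟨L, hL, hlast⟩ := h.exists_primary_aux a h.inside_left
    (by rintro rfl; exact h.limit_lt.false) h.right_gap_le_left_gap
  exact ⟨a :: L, fun t => ⟨⟨List.cons_ne_nil _ _, hL t⟩, rfl, hlast⟩⟩

end IsOrdered

end Robots

/-! ### Equidistance, persistence and covering by level chains. -/

namespace Robots

variable {ι : Type*} {V : ℝ} {a b : ι} {X : ℕ → ι → ℝ} {P : ι → ℝ} {lam rho : ι → ι}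

theorem eq_add_mul_of_midpoint {f : ℕ → ℝ} {n : ℕ}
    (hf : ∀ i, i + 2 ≤ n → 2 * f (i + 1) = f i + f (i + 2)) {i : ℕ} (hi : i ≤ n) :
    f i = f 0 + i * ((f n - f 0) / n) := by
  have key : ∀ i, (i ≤ n → f i = f 0 + i * (f 1 - f 0)) ∧
      (i + 1 ≤ n → f (i + 1) = f 0 + (i + 1) * (f 1 - f 0)) := by
    intro i
    induction i with
    | zero => simp
    | succ i ih =>
      refine ⟨fun hi => by exact_mod_cast ih.2 hi, fun hi => ?_⟩
      have h1 := hf i hi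
      rw [ih.1 (by omega), ih.2 (by omega)] at h1
      push_cast
      linarith
  rcases Nat.eq_zero_or_pos n with rfl | hn
  · simp [Nat.le_zero.1 hi]
  · have hn' : (n : ℝ) ≠ 0 := by positivity
    rw [(key i).1 hi, (key n).1 le_rfl, add_sub_cancel_left, mul_div_cancel_left₀ _ hn']

open IsOrdered (IsLink Inside)

section Lists

variable {p : ι → ℝ} {L : List ι}

theorem lt_of_isChain (hL : L.IsChain (IsLink V p)) {i j : ℕ} (hj : j < L.length) (hij : i < j) :
    p L[i] < p L[j] := by
  have h1 : L.IsChain fun u v => p u < p v := hL.imp fun _ _ h => h.1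
  have : IsTrans ι fun u v => p u < p v := ⟨fun _ _ _ => lt_trans⟩
  exact List.pairwise_iff_getElem.1 (List.isChain_iff_pairwise.1 h1) i j _ hj hij

theorem le_of_isChain (hL : L.IsChain (IsLink V p)) {i j : ℕ} (hj : j < L.length) (hij : i ≤ j) :
    p L[i] ≤ p L[j] := by
  rcases hij.lt_or_eq with hlt | rfl
  · exact (lt_of_isChain hL hj hlt).le
  · exact le_rfl

theorem head_le_of_isChain (hL : L.IsChain (IsLink V p)) {i : ι} (hi : i ∈ L) (hne : L ≠ []) :
    p (L.head hne) ≤ p i := by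
  obtain ⟨k, hk, rfl⟩ := List.getElem_of_mem hi
  rw [List.head_eq_getElem]
  exact le_of_isChain hL hk (Nat.zero_le _)

theorem le_getLast_of_isChain (hL : L.IsChain (IsLink V p)) {i : ι} (hi : i ∈ L) (hne : L ≠ []) :
    p i ≤ p (L.getLast hne) := by
  obtain ⟨k, hk, rfl⟩ := List.getElem_of_mem hi
  rw [List.getLast_eq_getElem]
  exact le_of_isChain hL (by omega) (by omega)

/-- Each position determines the next as its rightmost visible position; neither chain can continue
past `b`, as positions increase strictly. -/
theorem map_eq_of_isChain (L : List ι) : ∀ (L' : List ι) (i i' : ι), p i = p i' →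
    (i :: L).IsChain (IsLink V p) → (i' :: L').IsChain (IsLink V p) →
    (i :: L).getLast? = some b → (i' :: L').getLast? = some b →
    (i :: L).map p = (i' :: L').map p := by
  have lt_last : ∀ (L : List ι) (i j : ι), (i :: j :: L).IsChain (IsLink V p) →
      (i :: j :: L).getLast? = some b → p i < p b := by
    intro L i j hL hb
    rw [List.getLast?_eq_getElem?, List.getElem?_eq_some_iff] at hb
    obtain ⟨hk, hb⟩ := hb
    rw [← hb]
    exact lt_of_isChain (i := 0) hL hk (by simp)
  induction L with
  | nil =>
    rintro (_ | ⟨j', L'⟩) i i' hii hL hL' hb hb'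
    · simp [hii]
    · have h1 := lt_last _ _ _ hL' hb'
      obtain rfl : i = b := by simpa using hb
      exact absurd h1 (by simp [hii])
  | cons j L ih =>
    rintro (_ | ⟨j', L'⟩) i i' hii hL hL' hb hb'
    · have h1 := lt_last _ _ _ hL hb
      obtain rfl : i' = b := by simpa using hb'
      exact absurd h1 (by simp [hii])
    · rw [List.isChain_cons_cons] at hL hL'
      have hr : rightmost V p i = rightmost V p i' := by simp [rightmost, Visible, hii]
      rw [hL.1.2.1, hL'.1.2.1] at hr
      have := ih L' j j' hr hL.2 hL'.2 (by simpa using hb) (by simpa using hb')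
      rw [List.map_cons, this, hii, List.map_cons (l := j' :: L')]

end Lists

namespace IsOrdered

theorem rightmost_iff (h : IsOrdered V a b X P lam rho) (s t : ℕ) (u v : ι) :
    rightmost V (X s) u = X s v ↔ rightmost V (X t) u = X t v := by
  rw [h.rightmost_eq, h.rightmost_eq, h.eq_iff s, ← h.eq_iff t]

theorem leftmost_iff (h : IsOrdered V a b X P lam rho) (s t : ℕ) (u v : ι) :
    leftmost V (X s) u = X s v ↔ leftmost V (X t) u = X t v := by
  rw [h.leftmost_eq, h.leftmost_eq, h.eq_iff s, ← h.eq_iff t]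

theorem isMutualChain_iff (h : IsOrdered V a b X P lam rho) (s t : ℕ) {L : List ι} :
    IsMutualChain V (X s) L ↔ IsMutualChain V (X t) L := by
  simp only [IsMutualChain, h.rightmost_iff s t, h.leftmost_iff s t, h.lt_iff s, h.lt_iff t]

theorem isAnchoredAt_iff (h : IsOrdered V a b X P lam rho) (s t : ℕ) {L : List ι} {u v : ι} :
    IsAnchoredAt V (X s) L u v ↔ IsAnchoredAt V (X t) L u v := by
  simp only [IsAnchoredAt, h.rightmost_iff s t, h.leftmost_iff s t, h.lt_iff s, h.lt_iff t]

theorem isLevelChain_persists (h : IsOrdered V a b X P lam rho) (s t : ℕ) {j : ℕ} {L : List ι}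
    (hL : IsLevelChain V a b (X s) j L) : IsLevelChain V a b (X t) j L := by
  induction hL with
  | primary hL => exact .primary ⟨(h.isMutualChain_iff s t).1 hL.1, hL.2⟩
  | left hL hanc _ hu _ hv hlt ih1 ih2 =>
    exact .left ((h.isMutualChain_iff s t).1 hL) ((h.isAnchoredAt_iff s t).1 hanc) ih1 hu ih2 hv hlt
  | right hL hanc _ hu _ hv hlt ih1 ih2 =>
    exact .right ((h.isMutualChain_iff s t).1 hL) ((h.isAnchoredAt_iff s t).1 hanc)
      ih1 hu ih2 hv hlt

theorem between_of_anchored {L : List ι} (hL : IsMutualChain V (X 0) L) {u v : ι}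
    (hanc : IsAnchoredAt V (X 0) L u v) (hu : Inside a b X u) (hv : Inside a b X v) {i : ι}
    (hi : i ∈ L) : X 0 a < X 0 i ∧ X 0 i < X 0 b := by
  obtain ⟨hne, ⟨-, h1⟩, -, h2⟩ := hanc
  exact ⟨hu.1.trans_lt (h1.trans_le (head_le_of_isChain hL.2 hi hne)),
    ((le_getLast_of_isChain hL.2 hi hne).trans_lt h2).trans_le hv.2⟩

theorem inside_of_isLevelChain {j : ℕ} {L : List ι}
    (hL : IsLevelChain V a b (X 0) j L) : ∀ i ∈ L, Inside a b X i := by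
  induction hL with
  | primary hL =>
    intro i hi
    obtain ⟨hL, ha, hb⟩ := hL
    have hne := List.ne_nil_of_mem hi
    have h1 := head_le_of_isChain hL.2 hi hne
    have h2 := le_getLast_of_isChain hL.2 hi hne
    rw [List.head?_eq_some_head hne, Option.some_inj] at ha
    rw [List.getLast?_eq_some_getLast hne, Option.some_inj] at hb
    rw [ha] at h1
    rw [hb] at h2
    exact ⟨h1, h2⟩
  | left hL hanc _ hu _ hv _ ih1 ih2 =>
    intro i hi
    have := between_of_anchored hL hanc (ih1 _ hu) (ih2 _ hv) hi
    exact ⟨this.1.le, this.2.le⟩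
  | right hL hanc _ hu _ hv _ ih1 ih2 =>
    intro i hi
    have := between_of_anchored hL hanc (ih1 _ hu) (ih2 _ hv) hi
    exact ⟨this.1.le, this.2.le⟩

theorem between_of_isLevelChain {j : ℕ} {L : List ι} (hj : 2 ≤ j)
    (hL : IsLevelChain V a b (X 0) j L) :
    IsMutualChain V (X 0) L ∧ ∀ i ∈ L, X 0 a < X 0 i ∧ X 0 i < X 0 b := by
  cases hL with
  | primary _ => omega
  | left hL hanc h1 hu h2 hv _ =>
    exact ⟨hL, fun i => between_of_anchored hL hanc (inside_of_isLevelChain h1 _ hu)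
      (inside_of_isLevelChain h2 _ hv)⟩
  | right hL hanc h1 hu h2 hv _ =>
    exact ⟨hL, fun i => between_of_anchored hL hanc (inside_of_isLevelChain h1 _ hu)
      (inside_of_isLevelChain h2 _ hv)⟩

theorem midpoint (h : IsOrdered V a b X P lam rho) {u v w : ι} (hv : X 0 a < X 0 v ∧ X 0 v < X 0 b)
    (hu : leftmost V (X 0) v = X 0 u) (hw : rightmost V (X 0) v = X 0 w) :
    2 * P v = P u + P w := by
  rw [h.leftmost_eq] at hu
  rw [h.rightmost_eq] at hw
  rw [h.two_mul_limit ⟨?_, ?_⟩, h.limit_eq hu, h.limit_eq hw]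
  · rintro rfl; exact hv.1.false
  · rintro rfl; exact hv.2.false

theorem primary_equidistant (h : IsOrdered V a b X P lam rho) {L : List ι}
    (hL : IsPrimaryChain V a b (X 0) L) {i : ℕ} (hi : i < L.length) :
    P L[i] = P a + i * ((P b - P a) / ((L.length : ℝ) - 1)) := by
  obtain ⟨⟨hne, hL⟩, ha, hb⟩ := hL
  have hpos := List.length_pos_iff.2 hne
  rw [List.head?_eq_getElem?, List.getElem?_eq_some_iff] at ha
  rw [List.getLast?_eq_getElem?, List.getElem?_eq_some_iff] at hb
  obtain ⟨h0, ha⟩ := ha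
  obtain ⟨hn, hb⟩ := hb
  have key := eq_add_mul_of_midpoint (f := fun i => P (L.getD i a)) (n := L.length - 1)
    (fun i hi => ?_) (i := i) (by omega)
  · simpa [List.getD_eq_getElem, hi, h0, hn, ha, hb, Nat.cast_sub (Nat.succ_le_of_lt hpos)]
      using key
  · have h1 : i < L.length := by omega
    have h2 : i + 1 < L.length := by omega
    have h3 : i + 2 < L.length := by omega
    simp only [List.getD_eq_getElem _ _ h1, List.getD_eq_getElem _ _ h2,
      List.getD_eq_getElem _ _ h3]
    refine h.midpoint ⟨?_, ?_⟩ ?_ ?_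
    · rw [← ha]
      exact lt_of_isChain hL h2 (by omega)
    · rw [← hb]
      exact lt_of_isChain hL hn (by omega)
    · exact (List.isChain_iff_getElem.1 hL i h2).2.2
    · exact (List.isChain_iff_getElem.1 hL (i + 1) h3).2.1

theorem level_equidistant (h : IsOrdered V a b X P lam rho) {j : ℕ} {L : List ι} {u v : ι}
    (hj : 2 ≤ j) (hL : IsLevelChain V a b (X 0) j L) (hanc : IsAnchoredAt V (X 0) L u v) {i : ℕ}
    (hi : i < L.length) :
    P L[i] = P u + ((i : ℝ) + 1) * ((P v - P u) / ((L.length : ℝ) + 1)) := by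
  obtain ⟨⟨hne, hL⟩, hbet⟩ := between_of_isLevelChain hj hL
  obtain ⟨_, ⟨hu, -⟩, hv, -⟩ := hanc
  rw [List.head_eq_getElem] at hu
  rw [List.getLast_eq_getElem] at hv
  -- Adding the anchors shifts indices by one and makes every robot of `L` an interior point of a
  -- list with `L.length + 1` steps.
  set M : List ι := u :: L ++ [v] with hM
  have hlen : M.length = L.length + 2 := by simp [hM]
  have hmid : ∀ k (hk : k < L.length), M.getD (k + 1) u = L[k] := by
    intro k hk
    simp [hM, List.getElem?_append_left hk, hk]
  have hlast : M.getD (L.length + 1) u = v := by simp [hM]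
  have key := eq_add_mul_of_midpoint (f := fun i => P (M.getD i u)) (n := L.length + 1)
    (fun k hk => ?_) (i := i + 1) (by omega)
  · have h0 : M.getD 0 u = u := by simp [hM]
    simp only [hmid i hi, hlast, h0] at key
    exact_mod_cast key
  · have hk' : k < L.length := by omega
    simp only [hmid k hk']
    refine h.midpoint (hbet _ (List.getElem_mem hk')) ?_ ?_
    · rcases k with _ | k
      · simpa [hM] using hu
      · rw [hmid k (by omega)]
        exact (List.isChain_iff_getElem.1 hL k hk').2.2
    · rcases Nat.lt_or_ge (k + 1) L.length with hlt | hge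
      · rw [hmid (k + 1) hlt]
        exact (List.isChain_iff_getElem.1 hL k hlt).2.1
      · obtain rfl : k = L.length - 1 := by omega
        rw [show L.length - 1 + 2 = L.length + 1 by omega, hlast]
        exact hv

variable [Finite ι]

/-- Every robot between the crashed ones belongs to a level chain. Among the others, one with maximal
limit gap would start a mutual chain anchored at robots that do belong to level chains. -/
theorem exists_isLevelChain (h : IsOrdered V a b X P lam rho) {i : ι} (hi : Inside a b X i) :
    ∃ j L, IsLevelChain V a b (X 0) j L ∧ i ∈ L := by
  by_contra hi'
  set C : ι → Prop := fun i => ∃ j L, IsLevelChain V a b (X 0) j L ∧ i ∈ L with hC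
  obtain ⟨L₀, hL₀⟩ := h.exists_primary
  have hCa : C a := ⟨1, L₀, .primary (hL₀ 0), List.mem_of_mem_head? (hL₀ 0).2.1⟩
  have hCb : C b := ⟨1, L₀, .primary (hL₀ 0), List.mem_of_getLast? (hL₀ 0).2.2⟩
  set U : Set ι := {i | Inside a b X i ∧ ¬C i} with hU
  have hUne : ∀ i ∈ U, i ≠ a ∧ i ≠ b := by
    intro i hi
    constructor
    · rintro rfl; exact hi.2 hCa
    · rintro rfl; exact hi.2 hCb
  obtain ⟨e, he, hemax⟩ := Set.exists_max_image U (fun i => P (rho i) - P i) (Set.toFinite _)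
    ⟨i, hi, hi'⟩
  -- Among the uncovered robots with the largest right gap, `w` has the smallest limit; the new
  -- chain starts there.
  obtain ⟨w, hw, hwmin⟩ := Set.exists_min_image
    {i | i ∈ U ∧ P (rho i) - P i = P (rho e) - P e} P (Set.toFinite _) ⟨e, he, rfl⟩
  -- While `rho i` is uncovered its gap is neither smaller nor, by maximality, larger than that of
  -- `i`. So the link is mutual and the walk continues until it meets a covered robot `v`.
  have right : ∀ i, i ∈ U → P (rho i) - P i = P (rho e) - P e →
      ∃ (L : List ι) (v : ι), (i :: L).IsChain (IsLink V (X 0)) ∧ C v ∧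
        rightmost V (X 0) ((i :: L).getLast (List.cons_ne_nil _ _)) = X 0 v ∧
        X 0 ((i :: L).getLast (List.cons_ne_nil _ _)) < X 0 v := by
    refine descending_induction P fun i ih hi hgap => ?_
    have hib := (hUne i hi).2
    by_cases hv : C (rho i)
    · exact ⟨[], rho i, .singleton _, hv, h.rightmost_eq 0 i,
        h.lt_of_limit_lt 0 _ _ (h.limit_lt_rho hi.1 hib)⟩
    · have hmem : rho i ∈ U := ⟨h.inside_rho hi.1 hib, hv⟩
      have h1 := hemax _ hmem
      have h2 := h.two_mul_limit (hUne _ hmem)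
      have h3 := h.lam_limit_le (h.visible_rho i).symm
      obtain ⟨L, v, hL, hv, hr, hlt⟩ := ih (rho i) (h.limit_lt_rho hi.1 hib) hmem (by linarith)
      exact ⟨rho i :: L, v,
        List.isChain_cons_cons.2 ⟨h.isLink_rho hi.1 hib (by linarith) 0, hL⟩, hv,
        by simpa using hr, by simpa using hlt⟩
  -- If `lam w` were uncovered, its right gap would be at least the left gap of `w`, hence maximal,
  -- contradicting the choice of `w`.
  have hleft : C (lam w) := by
    by_contra hnC
    have hmem : lam w ∈ U := ⟨h.inside_lam hw.1.1 (hUne w hw.1).1, hnC⟩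
    have h1 := hemax _ hmem
    have h2 := h.two_mul_limit (hUne _ hw.1)
    have h3 := h.limit_le_rho (h.visible_lam w).symm
    have h4 := hw.2
    have h5 := hwmin (lam w) ⟨hmem, by linarith⟩
    exact h5.not_gt (h.lam_limit_lt hw.1.1 (hUne w hw.1).1)
  obtain ⟨L, v, hL, ⟨j₂, L₂, hL₂, hv⟩, hr, hlt⟩ := right w hw.1 hw.2
  obtain ⟨j₁, L₁, hL₁, hu⟩ := hleft
  have hchain : IsMutualChain V (X 0) (w :: L) := ⟨List.cons_ne_nil _ _, hL⟩
  have hanc : IsAnchoredAt V (X 0) (w :: L) (lam w) v :=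
    ⟨List.cons_ne_nil _ _, ⟨h.leftmost_eq 0 w,
      h.lt_of_limit_lt 0 _ _ (h.lam_limit_lt hw.1.1 (hUne w hw.1).1)⟩, hr, hlt⟩
  refine hw.1.2 ?_
  rcases le_total j₂ j₁ with hle | hle
  · exact ⟨j₁ + 1, w :: L, .left hchain hanc hL₁ hu hL₂ hv (by omega), List.mem_cons_self⟩
  · exact ⟨j₂ + 1, w :: L, .right hchain hanc hL₁ hu hL₂ hv (by omega), List.mem_cons_self⟩

end IsOrdered

/-! ### From an arbitrary size-stable time to the hierarchy. -/

variable [Finite ι]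

theorem IsTrajectory.isSettled_of_isSizeStable (h : IsTrajectory V a b X) (hlt : X 0 a < X 0 b)
    (hlim : ∀ i, Tendsto (fun t => X t i) atTop (𝓝 (P i)))
    (hc : (visibilityGraph V (X 0)).Connected) {T : ℕ} (hT : IsSizeStable V a b X T) :
    IsSettled V a b (fun t => X (T + t)) P ∧
      ∀ t i j, X (T + t) i < X (T + t) j ↔ X T i < X T j := by
  have hord : ∀ t i j, X (T + t) i < X (T + t) j ↔ X T i < X T j := by
    intro t i j
    induction t with
    | zero => rfl
    | succ t ih => rw [← ih]; exact hT.same_order (T + t) (Nat.le_add_right _ _) i j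
  have htend : ∀ i, Tendsto (fun t => X (T + t) i) atTop (𝓝 (P i)) := fun i =>
    ((tendsto_add_atTop_iff_nat T).2 (hlim i)).congr fun t => by rw [add_comm]
  refine ⟨?_, hord⟩
  exact
    { toIsTrajectory := h.shift T
      limit_lt := by
        rwa [tendsto_nhds_unique (hlim a)
            (tendsto_const_nhds.congr fun t => (h.left_fixed t).symm),
          tendsto_nhds_unique (hlim b)
            (tendsto_const_nhds.congr fun t => (h.right_fixed t).symm)]
      tendsto := htend
      visible_iff := fun t i j => by
        refine ⟨fun hv => ?_, h.visible_of_le (Nat.le_add_right T t)⟩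
        induction t with
        | zero => exact hv
        | succ t ih => exact ih (hT.no_inclusion (T + t) (Nat.le_add_right _ _) i j hv)
      lt_of_limit_lt := fun t i j hij => by
        by_contra hle
        rw [hord] at hle
        refine hij.not_ge (le_of_tendsto_of_tendsto' (htend j) (htend i) fun s => ?_)
        rw [← not_lt, hord]
        exact hle
      mem_of_closed := fun A hA hcl => mem_of_closed_of_connected hc A hA fun i hi j hij =>
        hcl i hi j (h.visible_of_le (Nat.zero_le _) hij) }

theorem IsTrajectory.isHierarchical (h : IsTrajectory V a b X) (hlt : X 0 a < X 0 b)
    (hlim : ∀ i, Tendsto (fun t => X t i) atTop (𝓝 (P i)))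
    (hc : (visibilityGraph V (X 0)).Connected) {T : ℕ} (hT : IsSizeStable V a b X T) :
    IsHierarchical V a b X P T := by
  obtain ⟨hs, hord⟩ := h.isSettled_of_isSizeStable hlt hlim hc hT
  obtain ⟨lam, rho, ho⟩ := hs.exists_isOrdered hord
  have hadd : ∀ t ≥ T, ∃ s, t = T + s := fun t ht => ⟨t - T, by omega⟩
  refine ⟨?_, ?_, fun L hL i hi => ho.primary_equidistant hL hi, ?_,
    fun j L u v hj hL hanc i hi => ho.level_equidistant hj hL hanc hi, fun i => ?_⟩
  · obtain ⟨L, hL⟩ := ho.exists_primary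
    refine ⟨L, fun t ht => ?_⟩
    obtain ⟨s, rfl⟩ := hadd t ht
    exact hL s
  · rintro t - L L' ⟨⟨hne, hL⟩, ha, hb⟩ ⟨⟨hne', hL'⟩, ha', hb'⟩
    obtain ⟨i, L, rfl⟩ := List.exists_cons_of_ne_nil hne
    obtain ⟨i', L', rfl⟩ := List.exists_cons_of_ne_nil hne'
    obtain rfl : i = a := by simpa using ha
    obtain rfl : i' = i := by simpa using ha'
    exact map_eq_of_isChain L L' _ _ rfl hL hL' hb hb'
  · intro j L hL t ht
    obtain ⟨s, rfl⟩ := hadd t ht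
    exact ho.isLevelChain_persists 0 s hL
  · rcases lt_or_ge (X T i) (X T a) with hia | hia
    · refine Or.inr (Or.inl ⟨fun t ht => ?_, (hs.ne_of_lt_left (t := 0) hia).2⟩)
      obtain ⟨s, rfl⟩ := hadd t ht
      exact (hord s i a).2 hia
    rcases lt_or_ge (X T b) (X T i) with hib | hib
    · refine Or.inr (Or.inr ⟨fun t ht => ?_, (hs.ne_of_right_lt (t := 0) hib).2⟩)
      obtain ⟨s, rfl⟩ := hadd t ht
      exact (hord s b i).2 hib
    exact Or.inl (ho.exists_isLevelChain ⟨hia, hib⟩)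

end Robots

theorem mainTheorem1 {ι : Type*} [Fintype ι] (V : ℝ) (hV : 0 < V) (a b : ι) (p : ι → ℝ)
    (hab : p a < p b) :
    (∀ i, Tendsto (fun t => |Robots.config V a b p (t + 1) i - Robots.config V a b p t i|)
      atTop (𝓝 0)) ∧
    ∃ P : ι → ℝ,
      (∀ i, Tendsto (fun t => Robots.config V a b p t i) atTop (𝓝 (P i))) ∧
      ((Robots.visibilityGraph V p).Connected →
        (∃ T, Robots.IsSizeStable V a b (Robots.config V a b p) T) ∧
        ∀ T, Robots.IsSizeStable V a b (Robots.config V a b p) T →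
          Robots.IsHierarchical V a b (Robots.config V a b p) P T) := by
  have h := Robots.isTrajectory_config (a := a) (b := b) hV p
  choose P hP using h.exists_tendsto
  refine ⟨fun i => ?_, P, hP, fun hc => ⟨h.exists_isSizeStable hab hP hc, fun T hT =>
    h.isHierarchical hab hP hc hT⟩⟩
  simpa using (((tendsto_add_atTop_iff_nat 1).2 (hP i)).sub (hP i)).abs
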